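/- Let $q=p^h$ be a prime power, let $k\geq 1$, and let $M$ be a non-singular $k\times k$ circulant matrix over $\mathbb F_{q^2}$ with first row $x=(x_1,\ldots,x_k)$, that is, $M_{ij}=x_{j-i+1}$ with indices read modulo $k$. Suppose that for all $m=1,\ldots,\lfloor k/2\rfloor$ every $m\times m$ submatrix of $M$ is non-singular and $$H_m(x)=\sum_{i=1}^k x_i x_{i+m}^q=0$$ (indices modulo $k$), and that $\sum_{i=1}^k x_i^{q+1}\neq 0$. Then for every $r=0,\ldots,k-1$ there exists a $[\![2k-r,\,r,\,k+1-r]\!]_q$ quantum MDS code. Here $\mathbb C^q$ has orthonormal basis $\{|y\rangle : y\in\mathbb F_q\}$, and a Pauli error on $(\mathbb C^q)^{\otimes n}$ is a tensor product $E=\bigotimes_{i=1}^n X(a_i)Z(b_i)$ with $a_i,b_i\in\mathbb F_q$, where $X(a)|y\rangle=|y+a\rangle$ and $Z(b)|y\rangle=e^{2\pi i\,\mathrm{tr}(by)/p}|y\rangle$, $\mathrm{tr}$ being the trace from $\mathbb F_q$ to $\mathbb F_p$; its weight is the number of tensor components that are not the identity. An $[\![n,s,d]\!]_q$ quantum code is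 a $q^s$-dimensional subspace $Q$ of $(\mathbb C^q)^{\otimes n}$ with minimum distance $d$: $d$ is the smallest weight of a non-identity Pauli error $E$ that $Q$ does not detect. If $P$ is the orthogonal projection onto $Q$, then $Q$ detects $E$ if $PEP=cP$ for some $c\in\mathbb C$; by the usual convention, if $\dim Q=1$ then $PEP=0$ is required instead. The code is quantum MDS if $s=n-2d+2$, that is, if it attains the quantum Singleton bound. -/

import Mathlib

open scoped Matrix

namespace QuantumCode

noncomputable section

section Pauli

variable {F : Type*} [Field F] [Fintype F] [DecidableEq F]

/-- The operator `X(a)` on `ℂ^q`, as a matrix in the basis `|x⟩`, `x ∈ F = 𝔽_q`: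
`X(a)|x⟩ = |x + a⟩`. -/
def pauliX (a : F) : Matrix F F ℂ :=
  Matrix.of fun y x => if y = x + a then 1 else 0

/-- The operator `Z(b)` on `ℂ^q`: `Z(b)|x⟩ = exp(2πi tr(bx)/p)|x⟩`, where `tr` is the trace
from `F = 𝔽_q` to `𝔽_p`. -/
def pauliZ (p : ℕ) [Algebra (ZMod p) F] (b : F) : Matrix F F ℂ :=
  Matrix.diagonal fun x =>
    Complex.exp (2 * Real.pi * Complex.I * ((Algebra.trace (ZMod p) F (b * x)).val : ℂ) / (p : ℂ))

/-- The generalised Pauli operator `X(a)Z(b)` on `ℂ^q`. -/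
def pauli (p : ℕ) [Algebra (ZMod p) F] (a b : F) : Matrix F F ℂ :=
  pauliX a * pauliZ p b

/-- The Pauli error `X(a₁)Z(b₁) ⊗ ⋯ ⊗ X(aₙ)Z(bₙ)` on `(ℂ^q)^{⊗n}`, as a matrix in the basis
`|x₁⟩ ⊗ ⋯ ⊗ |xₙ⟩`, `x ∈ Fⁿ` (an iterated Kronecker product). -/
def pauliError (p : ℕ) [Algebra (ZMod p) F] {n : ℕ} (a b : Fin n → F) :
    Matrix (Fin n → F) (Fin n → F) ℂ :=
  Matrix.of fun y x => ∏ i, pauli p (a i) (b i) (y i) (x i)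

/-- The weight of a Pauli error: the number of tensor components that are not the identity. -/
def errorWeight (p : ℕ) [Algebra (ZMod p) F] {n : ℕ} (a b : Fin n → F) : ℕ :=
  Set.ncard {i | pauli p (a i) (b i) ≠ 1}

end Pauli

/-- The Hilbert space `(ℂ^q)^{⊗n}`, with orthonormal basis `|x₁⟩ ⊗ ⋯ ⊗ |xₙ⟩` indexed by
`x ∈ Fⁿ`, where `F = 𝔽_q`. -/
abbrev States (F : Type*) [Fintype F] (n : ℕ) : Type _ :=
  EuclideanSpace ℂ (Fin n → F)

section Codes

variable {F : Type*} [Field F] [Fintype F] [DecidableEq F] {n : ℕ}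

/-- The code `Q` detects the operator `E`: with `P` the orthogonal projection onto `Q`,
`P E P = c P` for some scalar `c`. -/
def Detects (Q : Submodule ℂ (States F n)) (E : Matrix (Fin n → F) (Fin n → F) ℂ) : Prop :=
  ∃ c : ℂ, ∀ u ∈ Q, ∀ v ∈ Q, inner ℂ u (Matrix.toEuclideanLin E v) = c * inner ℂ u v

/-- The code `Q` detects `E` purely: `P E P = 0`. -/
def DetectsPurely (Q : Submodule ℂ (States F n))
    (E : Matrix (Fin n → F) (Fin n → F) ℂ) : Prop :=
  ∀ u ∈ Q, ∀ v ∈ Q, inner ℂ u (Matrix.toEuclideanLin E v) = 0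

/-- `Q` has minimum distance `d`: this is the smallest weight of a non-identity Pauli error that
`Q` does not detect. Every operator is detected by a one-dimensional code; for such codes
the usual convention is that detection is understood as pure detection. -/
def HasMinDist (p : ℕ) [Algebra (ZMod p) F] (Q : Submodule ℂ (States F n)) (d : ℕ) : Prop :=
  IsLeast {w : ℕ | ∃ a b : Fin n → F, errorWeight p a b = w ∧ 0 < w ∧
    ((Module.finrank ℂ Q ≠ 1 ∧ ¬ Detects Q (pauliError p a b)) ∨
      (Module.finrank ℂ Q = 1 ∧ ¬ DetectsPurely Q (pauliError p a b)))} d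

/-- `Q` is an `⟦n, k, d⟧_q` quantum code, `q = |F|`: a `q^k`-dimensional subspace of
`(ℂ^q)^{⊗n}` with minimum distance `d`. -/
def IsCode (p : ℕ) [Algebra (ZMod p) F] (Q : Submodule ℂ (States F n)) (k d : ℕ) : Prop :=
  Module.finrank ℂ Q = Fintype.card F ^ k ∧ HasMinDist p Q d

/-- `Q` is an `⟦n, k, d⟧_q` quantum MDS code: an `⟦n, k, d⟧_q` quantum code with
`k = n - 2d + 2`. -/
def IsMDSCode (p : ℕ) [Algebra (ZMod p) F] (Q : Submodule ℂ (States F n)) (k d : ℕ) : Prop :=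
  IsCode p Q k d ∧ (k : ℤ) = (n : ℤ) - 2 * (d : ℤ) + 2

end Codes

section Circulant

variable {K : Type*} {k : ℕ} [NeZero k]

/-- The circulant matrix with first row `x`; each row is the cyclic shift to the right of the
previous one, so the `(i, j)` entry is `x (j - i)`, indices modulo `k`. -/
def rowCirculant (x : Fin k → K) : Matrix (Fin k) (Fin k) K :=
  (Matrix.circulant x)ᵀ

/-- `H_m(x) = ∑ᵢ xᵢ x_{i+m}^q`, indices modulo `k`. -/
def H [Field K] (q m : ℕ) (x : Fin k → K) : K :=
  ∑ i : Fin k, x i * x (i + Fin.ofNat k m) ^ q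

end Circulant

end

end QuantumCode

/-! Let A be the circulant matrix and c = ∑ xᵢ^(q+1). The conditions H_m = 0 say A A† = c I, where †
is the conjugate transpose for y ↦ y^q. Since c lies in 𝔽_q and the norm is surjective, some l has
l^(q+1) c = -1, and then the code C with generator matrix [I | lA] is Hermitian self-dual of length
2k. It is MDS, with minimum weight at least k + 1: minors up to order k/2 suffice, because a message
of weight above k/2 can be exchanged with its image by inverting A through A†
(`SmallMinorsNeZero.lt_hammingNorm_add_of_mul_eq`).

Dropping r coordinates of the right half gives D, whose nonzero weights are at least k + 1 - r. In a
basis of 𝔽_q² over 𝔽_q, the symplectic dual S of D consists of words that extend by zero to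
Hermitian-orthogonal words of C, hence to words of C; so S is the shortened code and S ⊆ D = S^⊥.
The Pauli errors labelled by S commute, and a joint eigenspace of them is the quantum code
(`exists_isCode`): its dimension is q^n / |S| = q^r, errors outside D are detected purely, and a
word of weight k + 1 - r in D gives an undetected error. -/

namespace QuantumCode
noncomputable section

/-! ### The additive character of 𝔽_q given by the trace -/

section Character

variable (p : ℕ) [Fact p.Prime] (F : Type*) [Field F] [Algebra (ZMod p) F]

/-- The additive character `x ↦ exp(2πi tr(x)/p)` of `F`. -/
def traceChar : AddChar F ℂ :=
  (ZMod.stdAddChar (N := p)).compAddMonoidHom (Algebra.trace (ZMod p) F).toAddMonoidHom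

variable {F}

lemma traceChar_apply (x : F) :
    traceChar p F x = Complex.exp
      (2 * Real.pi * Complex.I * ((Algebra.trace (ZMod p) F x).val : ℂ) / (p : ℂ)) := by
  have h := ZMod.stdAddChar_coe (N := p) ((Algebra.trace (ZMod p) F x).val : ℤ)
  push_cast at h
  rw [← h]
  simp [traceChar]

/-- The standard character of ℤ/p is injective, so a trivial shift by a would put a in the radical
of the trace form. -/
lemma traceChar_isPrimitive [Finite F] : (traceChar p F).IsPrimitive := by
  intro a ha h
  apply ha
  have hnd := (traceForm_nondegenerate (ZMod p) F).1
  apply hnd a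
  intro x
  have hx : traceChar p F (a * x) = 1 := by
    simpa using DFunLike.congr_fun h x
  apply ZMod.injective_stdAddChar (N := p)
  simpa [traceChar] using hx

lemma exists_traceChar_mul_ne_one [Finite F] {a : F} (ha : a ≠ 0) :
    ∃ x, traceChar p F (x * a) ≠ 1 := by
  by_contra! h
  refine traceChar_isPrimitive p ha ?_
  ext x
  simpa [mul_comm] using h x

end Character

lemma addChar_map_sum {ι A R : Type*} [AddCommMonoid A] [CommMonoid R] (ψ : AddChar A R)
    (s : Finset ι) (f : ι → A) : ψ (∑ i ∈ s, f i) = ∏ i ∈ s, ψ (f i) :=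
  map_prod ψ.toMonoidHom (fun i => Multiplicative.ofAdd (f i)) s

/-! ### The symplectic form and the commutation phase -/

section Symplectic

variable (p : ℕ) [Fact p.Prime] {F : Type*} [Field F] [Algebra (ZMod p) F] {n : ℕ}

/-- The scalar `exp(2πi tr(b_s · a_t)/p)` arising from the product of two Pauli errors. -/
def phase (s t : Fin n → F × F) : ℂ := traceChar p F (∑ i, (s i).2 * (t i).1)

/-- The symplectic form on `𝔽_q²ⁿ`. -/
def symp (F : Type*) [Field F] (n : ℕ) : LinearMap.BilinForm F (Fin n → F × F) :=
  LinearMap.mk₂ F (fun s t => ∑ i, ((s i).1 * (t i).2 - (s i).2 * (t i).1))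
    (fun _ _ _ => by
      simp only [Pi.add_apply, Prod.fst_add, Prod.snd_add, ← Finset.sum_add_distrib]
      exact Finset.sum_congr rfl fun i _ => by ring)
    (fun _ _ _ => by
      simp only [Pi.smul_apply, Prod.smul_fst, Prod.smul_snd, smul_eq_mul, Finset.mul_sum]
      exact Finset.sum_congr rfl fun i _ => by ring)
    (fun _ _ _ => by
      simp only [Pi.add_apply, Prod.fst_add, Prod.snd_add, ← Finset.sum_add_distrib]
      exact Finset.sum_congr rfl fun i _ => by ring)
    (fun _ _ _ => by
      simp only [Pi.smul_apply, Prod.smul_fst, Prod.smul_snd, smul_eq_mul, Finset.mul_sum]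
      exact Finset.sum_congr rfl fun i _ => by ring)

lemma symp_apply (s t : Fin n → F × F) :
    symp F n s t = ∑ i, ((s i).1 * (t i).2 - (s i).2 * (t i).1) := rfl

lemma symp_isAlt (F : Type*) [Field F] (n : ℕ) : (symp F n).IsAlt := fun s => by
  rw [symp_apply]
  exact Finset.sum_eq_zero fun i _ => by ring

lemma symp_nondegenerate (F : Type*) [Field F] (n : ℕ) : (symp F n).Nondegenerate := by
  refine (symp_isAlt F n).isRefl.nondegenerate_iff_separatingLeft.2 ?_
  intro s hs
  ext i
  · have h := hs (Pi.single i (0, 1))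
    rw [symp_apply, Finset.sum_eq_single i (fun j _ hj => by simp [hj]) (by simp)] at h
    simpa using h
  · have h := hs (Pi.single i (1, 0))
    rw [symp_apply, Finset.sum_eq_single i (fun j _ hj => by simp [hj]) (by simp)] at h
    simpa using h

lemma phase_eq_mul_phase (s t : Fin n → F × F) :
    phase p t s = traceChar p F (symp F n s t) * phase p s t := by
  rw [phase, phase, symp_apply, ← AddChar.map_add_eq_mul, ← Finset.sum_add_distrib]
  congr 1
  exact Finset.sum_congr rfl fun i _ => by ring

end Symplectic

/-! ### Pauli errors as operators: products, unitarity, traces -/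

section ErrorMap

variable (p : ℕ) [Fact p.Prime] {F : Type*} [Field F] [Fintype F] [DecidableEq F]
  [Algebra (ZMod p) F] {n : ℕ}

lemma pauli_apply (a b x y : F) :
    pauli p a b y x = if y = x + a then traceChar p F (b * x) else 0 := by
  simp [pauli, pauliX, pauliZ, Matrix.mul_diagonal, traceChar_apply]

lemma pauli_zero_zero : pauli p (0 : F) 0 = 1 := by
  ext y x
  simp [pauli_apply, Matrix.one_apply]

lemma trace_pauli (a b : F) :
    (pauli p a b).trace = if a = 0 ∧ b = 0 then (Fintype.card F : ℂ) else 0 := by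
  simp only [Matrix.trace, Matrix.diag_apply, pauli_apply]
  by_cases ha : a = 0
  · have h := AddChar.sum_mulShift b (traceChar_isPrimitive p (F := F))
    by_cases hb : b = 0
    · simp [ha, hb]
    · simp only [hb, if_false, Nat.cast_zero] at h
      simpa [ha, hb, mul_comm] using h
  · simp [ha]

lemma pauli_eq_one_iff (a b : F) : pauli p a b = 1 ↔ a = 0 ∧ b = 0 := by
  refine ⟨fun h => ?_, fun h => by rw [h.1, h.2, pauli_zero_zero]⟩
  by_contra hab
  have h1 := trace_pauli p a b
  rw [h, if_neg hab, Matrix.trace_one] at h1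
  simp at h1

/-- The Pauli error labelled by `s : 𝔽_q²ⁿ` as an operator on the state space. -/
def errorMap (s : Fin n → F × F) : States F n →ₗ[ℂ] States F n :=
  Matrix.toEuclideanLin (pauliError p (fun i => (s i).1) (fun i => (s i).2))

lemma errorWeight_eq_hammingNorm (s : Fin n → F × F) :
    errorWeight p (fun i => (s i).1) (fun i => (s i).2) = hammingNorm s := by
  rw [errorWeight, hammingNorm, ← Set.ncard_coe_finset]
  congr 1
  ext i
  simp [pauli_eq_one_iff, Prod.ext_iff]

lemma pauliError_apply (s : Fin n → F × F) (y x : Fin n → F) :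
    pauliError p (fun i => (s i).1) (fun i => (s i).2) y x =
      if y = x + (fun i => (s i).1) then traceChar p F (∑ i, (s i).2 * x i) else 0 := by
  simp only [pauliError, Matrix.of_apply, pauli_apply]
  split_ifs with h
  · subst h
    simp [addChar_map_sum]
  · obtain ⟨i, hi⟩ := Function.ne_iff.mp h
    exact Finset.prod_eq_zero (Finset.mem_univ i) (if_neg (by simpa using hi))

lemma errorMap_apply (s : Fin n → F × F) (v : States F n) (y : Fin n → F) :
    errorMap p s v y = traceChar p F (∑ i, (s i).2 * (y i - (s i).1)) *
      v (fun i => y i - (s i).1) := by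
  simp only [errorMap, Matrix.toLpLin_apply, Matrix.mulVec, dotProduct, pauliError_apply]
  rw [Finset.sum_eq_single (fun i => y i - (s i).1)]
  · rw [if_pos (by ext; simp)]
  · intro x _ hx
    rw [if_neg, zero_mul]
    rintro rfl
    exact hx (by ext; simp)
  · simp

lemma errorMap_errorMap (s t : Fin n → F × F) (v : States F n) :
    errorMap p s (errorMap p t v) = phase p s t • errorMap p (s + t) v := by
  ext y
  simp only [errorMap_apply, PiLp.smul_apply, smul_eq_mul, phase, Pi.add_apply, Prod.fst_add,
    Prod.snd_add, ← mul_assoc, ← AddChar.map_add_eq_mul, ← Finset.sum_add_distrib]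
  have h : (fun i => y i - (s i).1 - (t i).1) = fun i => y i - ((s i).1 + (t i).1) := by
    ext i
    ring
  rw [h]
  congr 2
  exact Finset.sum_congr rfl fun i _ => by ring

lemma errorMap_zero : errorMap p (0 : Fin n → F × F) = LinearMap.id := by
  ext v y
  simp [errorMap_apply]

lemma inner_errorMap (s : Fin n → F × F) (u v : States F n) :
    inner ℂ (errorMap p s u) (errorMap p s v) = inner ℂ u v := by
  simp only [PiLp.inner_apply, errorMap_apply]
  refine Fintype.sum_equiv (Equiv.subRight (fun i => (s i).1)) _ _ fun y => ?_
  have h : ∀ z : F, (starRingEnd ℂ) (traceChar p F z) * traceChar p F z = 1 := by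
    intro z
    rw [← AddChar.map_neg_eq_conj, ← AddChar.map_add_eq_mul]
    simp
  simp only [RCLike.inner_apply, map_mul, Equiv.subRight_apply]
  rw [mul_mul_mul_comm, mul_comm (traceChar p F _), h, one_mul]
  rfl

/-- The trace of a tensor product is the product of the traces, and only the identity Pauli has
nonzero trace. This gives both the dimension of the code and the existence of undetected errors. -/
lemma trace_errorMap (s : Fin n → F × F) :
    LinearMap.trace ℂ _ (errorMap p s) = if s = 0 then (Fintype.card F : ℂ) ^ n else 0 := by
  have h : LinearMap.trace ℂ _ (errorMap p s) = ∏ i, (pauli p (s i).1 (s i).2).trace := by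
    rw [errorMap, show Matrix.toEuclideanLin = _ from Matrix.toLpLin_eq_toLin 2 2,
      Matrix.trace_toLin_eq]
    simp only [Matrix.trace, Matrix.diag_apply, pauliError, Matrix.of_apply]
    rw [Finset.prod_univ_sum, Fintype.piFinset_univ]
  rw [h]
  simp only [trace_pauli]
  split_ifs with hs
  · subst hs
    simp
  · obtain ⟨i, hi⟩ := Function.ne_iff.mp hs
    exact Finset.prod_eq_zero (Finset.mem_univ i) (if_neg fun h => hi (Prod.ext h.1 h.2))

lemma errorMap_comm (s t : Fin n → F × F) (v : States F n) :
    errorMap p t (errorMap p s v) =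
      traceChar p F (symp F n s t) • errorMap p s (errorMap p t v) := by
  rw [errorMap_errorMap, errorMap_errorMap, phase_eq_mul_phase, mul_smul, add_comm]

end ErrorMap

/-- Induction on the set of operators: the joint eigenspace found so far is invariant under the next
operator, by commutation, so that operator has an eigenvector in it. -/
lemma exists_forall_apply_eq_smul {𝕜 V ι : Type*} [Field 𝕜] [IsAlgClosed 𝕜] [AddCommGroup V]
    [Module 𝕜 V] [FiniteDimensional 𝕜 V] [Nontrivial V] [Finite ι] (f : ι → Module.End 𝕜 V)
    (hf : ∀ i j v, f i (f j v) = f j (f i v)) :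
    ∃ (χ : ι → 𝕜) (v : V), v ≠ 0 ∧ ∀ i, f i v = χ i • v := by
  classical
  have := Fintype.ofFinite ι
  suffices h : ∀ T : Finset ι, ∃ (χ : ι → 𝕜) (v : V), v ≠ 0 ∧ ∀ i ∈ T, f i v = χ i • v by
    simpa using h Finset.univ
  intro T
  induction T using Finset.induction_on with
  | empty =>
    obtain ⟨v, hv⟩ := exists_ne (0 : V)
    exact ⟨0, v, hv, by simp⟩
  | insert j T hj ih =>
    obtain ⟨χ, v, hv, hT⟩ := ih
    let W : Submodule 𝕜 V := ⨅ i ∈ T, LinearMap.eqLocus (f i) (χ i • LinearMap.id)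
    have hW : ∀ w, w ∈ W ↔ ∀ i ∈ T, f i w = χ i • w := by
      intro w
      simp [W, Submodule.mem_iInf]
    have hmaps : ∀ w ∈ W, f j w ∈ W := by
      intro w hw
      rw [hW] at hw ⊢
      intro i hi
      rw [hf, hw i hi, map_smul]
    have : Nontrivial W := ⟨⟨⟨v, (hW v).2 hT⟩, 0, fun h => hv (congrArg Subtype.val h)⟩⟩
    obtain ⟨c, hc⟩ := Module.End.exists_eigenvalue ((f j).restrict hmaps)
    obtain ⟨w, hw⟩ := hc.exists_hasEigenvector
    refine ⟨Function.update χ j c, w, fun h => hw.2 (Subtype.ext h), fun i hi => ?_⟩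
    rcases Finset.mem_insert.mp hi with rfl | hi
    · simpa using congrArg Subtype.val hw.apply_eq_smul
    · rw [Function.update_of_ne (ne_of_mem_of_not_mem hi hj)]
      exact (hW _).1 w.2 i hi

/-! ### Stabilizer codes -/

section Stabilizer

variable (p : ℕ) [Fact p.Prime] {F : Type*} [Field F] [Fintype F] [DecidableEq F]
  [Algebra (ZMod p) F] {n : ℕ} (S : Submodule F (Fin n → F × F)) (χ : S → ℂ)

/-- The joint eigenspace, with eigenvalues `χ`, of the Pauli errors labelled by `S`. -/
def stabilizerCode : Submodule ℂ (States F n) :=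
  ⨅ s : S, LinearMap.eqLocus (errorMap p (s : Fin n → F × F)) (χ s • LinearMap.id)

variable {p S χ} in
lemma mem_stabilizerCode {v : States F n} :
    v ∈ stabilizerCode p S χ ↔ ∀ s : S, errorMap p (s : Fin n → F × F) v = χ s • v := by
  simp [stabilizerCode, Submodule.mem_iInf]

open Classical in
/-- The projection onto the joint eigenspace `stabilizerCode`. -/
def stabilizerProj : States F n →ₗ[ℂ] States F n :=
  (Fintype.card S : ℂ)⁻¹ • ∑ s : S, (χ s)⁻¹ • errorMap p (s : Fin n → F × F)

variable {p S χ}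

/-- Isotropy makes the errors commute. Reading χ off a common eigenvector avoids choosing phases
that would turn the errors labelled by S into a group. -/
lemma exists_eigenvalues (hS : ∀ s ∈ S, ∀ t ∈ S, symp F n s t = 0) :
    ∃ (χ : S → ℂ), ∃ v ∈ stabilizerCode p S χ, v ≠ 0 := by
  classical
  obtain ⟨χ, v, hv, h⟩ := exists_forall_apply_eq_smul
    (fun s : S => errorMap p (s : Fin n → F × F)) fun s t v => by
      rw [errorMap_comm, hS _ t.2 _ s.2]
      simp
  exact ⟨χ, v, mem_stabilizerCode.2 h, hv⟩

lemma conj_mul_eigenvalue {v : States F n} (hv : v ∈ stabilizerCode p S χ) (h0 : v ≠ 0) (s : S) :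
    (starRingEnd ℂ) (χ s) * χ s = 1 := by
  have h := inner_errorMap p (s : Fin n → F × F) v v
  rw [mem_stabilizerCode.1 hv, inner_smul_left, inner_smul_right, ← mul_assoc] at h
  exact mul_right_cancel₀ (inner_self_ne_zero.2 h0) (h.trans (one_mul _).symm)

/-- The eigenvalues obey the same cocycle as the errors, which is what makes the average
`stabilizerProj` idempotent. -/
lemma eigenvalue_mul {v : States F n} (hv : v ∈ stabilizerCode p S χ) (h0 : v ≠ 0) (s t : S) :
    χ s * χ t = phase p (s : Fin n → F × F) t * χ (s + t) := by
  have h := errorMap_errorMap p (s : Fin n → F × F) t v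
  rw [mem_stabilizerCode.1 hv t, map_smul, mem_stabilizerCode.1 hv s, ← Submodule.coe_add,
    mem_stabilizerCode.1 hv (s + t), smul_smul, smul_smul, mul_comm (χ t)] at h
  exact smul_left_injective ℂ h0 h

lemma eigenvalue_ne_zero {v : States F n} (hv : v ∈ stabilizerCode p S χ) (h0 : v ≠ 0) (s : S) :
    χ s ≠ 0 :=
  right_ne_zero_of_mul_eq_one (conj_mul_eigenvalue hv h0 s)

lemma eigenvalue_zero {v : States F n} (hv : v ∈ stabilizerCode p S χ) (h0 : v ≠ 0) :
    χ 0 = 1 := by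
  have h := mem_stabilizerCode.1 hv 0
  rw [Submodule.coe_zero, errorMap_zero, LinearMap.id_apply] at h
  exact smul_left_injective ℂ h0 (by simpa using h.symm)

lemma isProj_stabilizerProj {v : States F n} (hv : v ∈ stabilizerCode p S χ) (h0 : v ≠ 0) :
    LinearMap.IsProj (stabilizerCode p S χ) (stabilizerProj p S χ) := by
  classical
  have hN : (Fintype.card S : ℂ) ≠ 0 := Nat.cast_ne_zero.2 Fintype.card_ne_zero
  have hχ := eigenvalue_ne_zero hv h0
  refine ⟨fun w => mem_stabilizerCode.2 fun t => ?_, fun w hw => ?_⟩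
  · simp only [stabilizerProj, LinearMap.smul_apply, LinearMap.sum_apply, map_smul, map_sum]
    rw [smul_comm (χ t)]
    congr 1
    rw [Finset.smul_sum]
    refine Fintype.sum_equiv (Equiv.addLeft t) _ _ fun s => ?_
    simp only [Equiv.coe_addLeft]
    rw [errorMap_errorMap, smul_smul, smul_smul, Submodule.coe_add]
    congr 1
    have h := eigenvalue_mul hv h0 t s
    have h1 := hχ s
    have h2 := hχ (t + s)
    field_simp
    linear_combination -h
  · simp only [stabilizerProj, LinearMap.smul_apply, LinearMap.sum_apply,
      mem_stabilizerCode.1 hw, smul_smul, inv_mul_cancel₀ (hχ _)]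
    simp [← Nat.cast_smul_eq_nsmul ℂ, smul_smul, hN]

lemma trace_errorMap_comp_stabilizerProj {t : Fin n → F × F} (ht : t ∉ S) :
    LinearMap.trace ℂ _ (errorMap p t ∘ₗ stabilizerProj p S χ) = 0 := by
  classical
  have h : errorMap p t ∘ₗ stabilizerProj p S χ = (Fintype.card S : ℂ)⁻¹ •
      ∑ s : S, (χ s)⁻¹ • phase p t s • errorMap p (t + (s : Fin n → F × F)) := by
    ext1 v
    simp only [stabilizerProj, LinearMap.comp_apply, LinearMap.smul_apply, LinearMap.sum_apply,
      map_smul, map_sum, errorMap_errorMap]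
  simp only [h, map_smul, map_sum]
  rw [Finset.sum_eq_zero, smul_zero]
  intro s _
  rw [trace_errorMap, if_neg, smul_zero, smul_zero]
  intro h0
  apply ht
  rw [eq_neg_of_add_eq_zero_left h0]
  exact S.neg_mem s.2

/-- The rank of the projection is its trace, to which only s = 0 contributes: q^n / |S|. -/
lemma finrank_stabilizerCode {v : States F n} (hv : v ∈ stabilizerCode p S χ) (h0 : v ≠ 0) {r : ℕ}
    (hr : Module.finrank F S + r = n) :
    Module.finrank ℂ (stabilizerCode p S χ) = Fintype.card F ^ r := by
  classical
  have htr := (isProj_stabilizerProj hv h0).trace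
  simp only [stabilizerProj, map_smul, map_sum, trace_errorMap] at htr
  rw [Finset.sum_eq_single 0 (by simp +contextual) (by simp), eigenvalue_zero hv h0,
    Module.card_eq_pow_finrank (K := F) (V := S)] at htr
  have hq : (Fintype.card F : ℂ) ≠ 0 := Nat.cast_ne_zero.2 Fintype.card_ne_zero
  have hn : (Fintype.card F : ℂ) ^ n =
      (Fintype.card F : ℂ) ^ Module.finrank F S * (Fintype.card F : ℂ) ^ r := by
    rw [← pow_add, hr]
  rw [hn] at htr
  rw [← Nat.cast_inj (R := ℂ), ← htr]
  push_cast
  simp [hq]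

/-- A stabilizer element commuting with the error only up to a phase different from 1 forces the
inner product to equal a nontrivial multiple of itself. -/
lemma detectsPurely_stabilizerCode {v : States F n} (hv : v ∈ stabilizerCode p S χ) (h0 : v ≠ 0)
    {s t : Fin n → F × F} (hs : s ∈ S) (hst : symp F n s t ≠ 0) {u w : States F n}
    (hu : u ∈ stabilizerCode p S χ) (hw : w ∈ stabilizerCode p S χ) :
    inner ℂ u (errorMap p t w) = 0 := by
  -- The symplectic value may be nonzero with trace zero; since S is 𝔽_q-linear, s can be rescaled
  -- until the phase is nontrivial.
  obtain ⟨x, hx⟩ := exists_traceChar_mul_ne_one p hst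
  have hcomm := errorMap_comm p t (x • s) w
  have hxs : x • s ∈ S := S.smul_mem x hs
  have h := inner_errorMap p (x • s) u (errorMap p t w)
  have e := mem_stabilizerCode.1 hu ⟨x • s, hxs⟩
  have e' := mem_stabilizerCode.1 hw ⟨x • s, hxs⟩
  simp only at e e'
  have hform : symp F n t (x • s) = -(x * symp F n s t) := by
    rw [← (symp_isAlt F n).neg_eq, map_smul, LinearMap.smul_apply, smul_eq_mul]
  rw [hcomm, e, e', hform, map_smul, smul_smul, inner_smul_left, inner_smul_right] at h
  have hc := conj_mul_eigenvalue hv h0 ⟨x • s, hxs⟩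
  by_contra hne
  have h1 : traceChar p F (-(x * symp F n s t)) = 1 := by
    apply mul_right_cancel₀ hne
    linear_combination h - traceChar p F (-(x * symp F n s t)) *
      inner ℂ u (errorMap p t w) * hc
  rw [AddChar.map_neg_eq_inv, inv_eq_one] at h1
  exact hx h1

lemma errorMap_mem_stabilizerCode {t : Fin n → F × F} (ht : ∀ s ∈ S, symp F n s t = 0)
    {w : States F n} (hw : w ∈ stabilizerCode p S χ) : errorMap p t w ∈ stabilizerCode p S χ := by
  refine mem_stabilizerCode.2 fun s => ?_
  rw [errorMap_comm, ← (symp_isAlt F n).neg_eq, ht s s.2, mem_stabilizerCode.1 hw]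
  simp

/-- The bound `hmin` covers all of S^⊥, including S, so every smaller error is detected purely and
the convention for one-dimensional codes is met as well. The condition `t ∈ S ↔ r = 0` reflects that
convention: for r = 0 an error in S acts as a nonzero scalar, so it violates pure detection only,
while for r > 0 an undetected error must lie outside S. -/
theorem exists_isCode {r d : ℕ} (hS : ∀ s ∈ S, ∀ t ∈ S, symp F n s t = 0)
    (hr : Module.finrank F S + r = n) (hd : 0 < d)
    (hmin : ∀ t, t ≠ 0 → (∀ s ∈ S, symp F n s t = 0) → d ≤ hammingNorm t)
    (hex : ∃ t, (∀ s ∈ S, symp F n s t = 0) ∧ hammingNorm t = d ∧ (t ∈ S ↔ r = 0)) :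
    ∃ Q : Submodule ℂ (States F n), IsCode p Q r d := by
  classical
  obtain ⟨χ, v, hv, h0⟩ := exists_eigenvalues (p := p) hS
  have hdim := finrank_stabilizerCode hv h0 hr
  refine ⟨stabilizerCode p S χ, hdim, ?_, ?_⟩
  · obtain ⟨t, ht, htd, htS⟩ := hex
    refine ⟨fun i => (t i).1, fun i => (t i).2, (errorWeight_eq_hammingNorm p t).trans htd, hd, ?_⟩
    by_cases hr0 : r = 0
    · refine Or.inr ⟨by rw [hdim, hr0, pow_zero], fun hdet => ?_⟩
      have h : inner ℂ v (errorMap p t v) = 0 := hdet v hv v hv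
      rw [mem_stabilizerCode.1 hv ⟨t, htS.2 hr0⟩, inner_smul_right] at h
      exact mul_ne_zero (eigenvalue_ne_zero hv h0 _) (inner_self_ne_zero.2 h0) h
    · have htS' : t ∉ S := fun h => hr0 (htS.1 h)
      refine Or.inl ⟨by rw [hdim]; exact (Nat.one_lt_pow hr0 Fintype.one_lt_card).ne', ?_⟩
      rintro ⟨c, hc⟩
      have hscal : ∀ w ∈ stabilizerCode p S χ, errorMap p t w = c • w := by
        intro w hw
        have hmem : errorMap p t w - c • w ∈ stabilizerCode p S χ :=
          Submodule.sub_mem _ (errorMap_mem_stabilizerCode ht hw) (Submodule.smul_mem _ _ hw)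
        -- The error maps the code to itself, so the detection identity can be tested on the
        -- difference itself, which is then orthogonal to itself.
        have h : inner ℂ (errorMap p t w - c • w) (errorMap p t w) = _ := hc _ hmem w hw
        rw [← sub_eq_zero, ← inner_self_eq_zero (𝕜 := ℂ), inner_sub_right, inner_smul_right, h,
          sub_self]
      have hproj := isProj_stabilizerProj hv h0
      have hcomp : errorMap p t ∘ₗ stabilizerProj p S χ = c • stabilizerProj p S χ := by
        ext1 w
        exact hscal _ (hproj.map_mem w)
      -- For t outside S every term of the composite is traceless, so c q^r = 0; but c = 0
      -- contradicts unitarity.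
      have htr := trace_errorMap_comp_stabilizerProj (p := p) (χ := χ) htS'
      rw [hcomp, map_smul, hproj.trace, hdim, smul_eq_mul] at htr
      have hc0 : c = 0 := by simpa using htr
      have hv0 := inner_errorMap p t v v
      rw [hscal v hv, hc0, zero_smul, inner_zero_left] at hv0
      exact inner_self_ne_zero.2 h0 hv0.symm
  · rintro w ⟨a, b, hw, hw0, hnd⟩
    let t : Fin n → F × F := fun i => (a i, b i)
    have hwt : hammingNorm t = w := (errorWeight_eq_hammingNorm p t).symm.trans hw
    rw [← hwt]
    refine hmin t (fun h => ?_) fun s hs => ?_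
    · rw [h, hammingNorm_zero] at hwt
      exact hw0.ne hwt
    · by_contra hst
      have hdet : DetectsPurely (stabilizerCode p S χ) (pauliError p a b) :=
        fun u hu w hw => detectsPurely_stabilizerCode hv h0 hs hst hu hw
      rcases hnd with ⟨_, h⟩ | ⟨_, h⟩
      · exact h ⟨0, fun u hu w hw => by rw [hdet u hu w hw, zero_mul]⟩
      · exact h hdet

end Stabilizer

/-! ### Weights from non-vanishing minors -/

section HammingNorm

variable {K : Type*} [Field K] {k : ℕ}

/-- Every square submatrix of `A` of size at most `k / 2` is non-singular. -/
def SmallMinorsNeZero (A : Matrix (Fin k) (Fin k) K) : Prop :=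
  ∀ m : ℕ, 1 ≤ m → m ≤ k / 2 → ∀ f g : Fin m ↪o Fin k, (A.submatrix f g).det ≠ 0

lemma SmallMinorsNeZero.map_transpose {A : Matrix (Fin k) (Fin k) K}
    (hA : SmallMinorsNeZero A) (σ : K →+* K) : SmallMinorsNeZero (A.map σ)ᵀ := by
  intro m h1 h2 f g h
  have e : (A.map σ)ᵀ.submatrix f g = ((A.submatrix g f).map σ)ᵀ := rfl
  have h' : σ (A.submatrix g f).det = 0 := by
    rw [RingHom.map_det]
    rwa [e, Matrix.det_transpose] at h
  exact hA m h1 h2 g f ((map_eq_zero σ).1 h')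

variable [DecidableEq K]

/-- Otherwise v A has at least wt(v) zeros; the rows in the support of v and that many zero columns
form a square submatrix killed by the nonzero restriction of v. -/
lemma SmallMinorsNeZero.lt_hammingNorm_add {A : Matrix (Fin k) (Fin k) K}
    (hA : SmallMinorsNeZero A) {v : Fin k → K} (hv : v ≠ 0) (hv2 : hammingNorm v ≤ k / 2) :
    k < hammingNorm v + hammingNorm (v ᵥ* A) := by
  by_contra! hle
  have hZ := Finset.card_filter_add_card_filter_not (s := Finset.univ)
    (fun j => (v ᵥ* A) j ≠ 0)
  rw [Finset.card_univ, Fintype.card_fin] at hZ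
  obtain ⟨T, hTZ, hT⟩ := Finset.exists_subset_card_eq
    (s := Finset.univ.filter fun j => ¬ (v ᵥ* A) j ≠ 0) (n := hammingNorm v) (by
      unfold hammingNorm at hle ⊢
      omega)
  have hpos : 0 < hammingNorm v := hammingNorm_pos_iff.2 hv
  let f := (Finset.univ.filter fun i => v i ≠ 0).orderEmbOfFin (k := hammingNorm v) rfl
  let g := T.orderEmbOfFin hT
  have h0 : (fun i => v (f i)) ᵥ* A.submatrix f g = 0 := by
    ext j
    have hj : (v ᵥ* A) (g j) = 0 := by
      simpa using hTZ (T.orderEmbOfFin_mem hT j)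
    simp only [Matrix.vecMul, dotProduct, Matrix.submatrix_apply, Pi.zero_apply] at hj ⊢
    rw [← hj]
    refine Finset.sum_of_injOn f f.injective.injOn (by simp [Set.MapsTo]) (fun i _ hi => ?_)
      fun i _ => rfl
    have hi' : v i = 0 := by
      by_contra hne
      apply hi
      simpa [f, Finset.range_orderEmbOfFin] using hne
    rw [hi', zero_mul]
  have h1 := Matrix.eq_zero_of_vecMul_eq_zero (hA _ hpos hv2 f g) h0
  have h2 := Finset.orderEmbOfFin_mem (Finset.univ.filter fun i => v i ≠ 0)
    (k := hammingNorm v) rfl ⟨0, hpos⟩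
  rw [Finset.mem_filter] at h2
  exact h2.2 (congrFun h1 ⟨0, hpos⟩)

/-- If the bound failed with v of weight above k/2, then v A would have weight at most k/2. The
previous lemma then applies to v A and B, as (v A) B = c v has the weight of v. -/
lemma SmallMinorsNeZero.lt_hammingNorm_add_of_mul_eq {A B : Matrix (Fin k) (Fin k) K} {c : K}
    (hA : SmallMinorsNeZero A) (hB : SmallMinorsNeZero B) (hc : c ≠ 0)
    (hAB : A * B = c • (1 : Matrix (Fin k) (Fin k) K)) {v : Fin k → K} (hv : v ≠ 0) :
    k < hammingNorm v + hammingNorm (v ᵥ* A) := by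
  by_cases hv2 : hammingNorm v ≤ k / 2
  · exact hA.lt_hammingNorm_add hv hv2
  by_contra! hle
  have hcv : (v ᵥ* A) ᵥ* B = c • v := by
    rw [Matrix.vecMul_vecMul, hAB, Matrix.vecMul_smul, Matrix.vecMul_one]
  have h0 : v ᵥ* A ≠ 0 := by
    intro h
    rw [h, Matrix.zero_vecMul] at hcv
    exact smul_ne_zero hc hv hcv.symm
  have h := hB.lt_hammingNorm_add h0 (by omega)
  rw [hcv, hammingNorm_smul (fun _ => IsSMulRegular.of_ne_zero hc)] at h
  omega

end HammingNorm

/-! ### The Gram matrix of the circulant -/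

section Circulant

variable {K : Type*} [Field K] {k : ℕ} [NeZero k]

/-- The (i, j) entry is H at the index i - j. Indices above k/2 reduce to small ones, because H at
-d is the conjugate of H at d. -/
lemma rowCirculant_mul_map_transpose {q : ℕ} {x : Fin k → K} {σ : K →+* K}
    (hσ : ∀ y, σ y = y ^ q) (hσσ : ∀ y, σ (σ y) = y)
    (hH : ∀ m : ℕ, 1 ≤ m → m ≤ k / 2 → H q m x = 0) :
    rowCirculant x * ((rowCirculant x).map σ)ᵀ =
      (∑ i, x i ^ (q + 1)) • (1 : Matrix (Fin k) (Fin k) K) := by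
  have hgram : ∀ i j : Fin k, (rowCirculant x * ((rowCirculant x).map σ)ᵀ) i j =
      ∑ l, x l * σ (x (l + (i - j))) := by
    intro i j
    rw [Matrix.mul_apply]
    refine Fintype.sum_equiv (Equiv.subRight i) _ _ fun l => ?_
    simp [rowCirculant, Matrix.circulant_apply]
  have hzero : ∀ d : Fin k, d ≠ 0 → ∑ l, x l * σ (x (l + d)) = 0 := by
    have hsmall : ∀ d : Fin k, d ≠ 0 → (d : ℕ) ≤ k / 2 → ∑ l, x l * σ (x (l + d)) = 0 := by
      intro d hd hd2
      have h := hH d (Nat.one_le_iff_ne_zero.2 fun h => hd (Fin.ext (by simpa using h))) hd2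
      rw [H] at h
      simpa [hσ] using h
    intro d hd
    by_cases hd2 : (d : ℕ) ≤ k / 2
    · exact hsmall d hd hd2
    · have h := hsmall (-d) (neg_ne_zero.2 hd) (by
        rw [Fin.val_neg', Nat.mod_eq_of_lt]
        all_goals omega)
      have h' := congrArg σ h
      rw [map_zero, map_sum] at h'
      rw [← h']
      refine Fintype.sum_equiv (Equiv.addRight d) _ _ fun l => ?_
      simp [hσσ, mul_comm]
  ext i j
  rw [hgram, Matrix.smul_apply, Matrix.one_apply]
  split_ifs with hij
  · simp [hij, hσ, pow_succ']
  · simpa using hzero (i - j) (sub_ne_zero.2 hij)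

end Circulant

/-! ### The extension 𝔽_q² / 𝔽_q -/

section QuadraticExtension

variable {F K : Type*} [Field F] [Fintype F] [Field K] [Finite K] [Algebra F K]

local notation "σ" => FiniteField.frobeniusAlgHom F K

lemma frobenius_frobenius (h : Module.finrank F K = 2) (y : K) : σ (σ y) = y := by
  have e : (σ) ^ 2 = 1 := by
    rw [← h, ← FiniteField.orderOf_frobeniusAlgHom, pow_orderOf_eq_one]
  exact DFunLike.congr_fun e y

lemma exists_frobenius_ne (h : Module.finrank F K = 2) : ∃ β : K, σ β ≠ β := by
  by_contra! hall
  have e : (σ) = 1 := AlgHom.ext hall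
  have h1 := FiniteField.orderOf_frobeniusAlgHom F K
  rw [e, orderOf_one, h] at h1
  omega

lemma exists_coordinates (h : Module.finrank F K = 2) {β : K} (hβ : σ β ≠ β) :
    ∃ e : K ≃ₗ[F] F × F, ∀ y, y = algebraMap F K (e y).1 + algebraMap F K (e y).2 * β := by
  let L : F × F →ₗ[F] K := LinearMap.coprod (Algebra.linearMap F K)
    (LinearMap.toSpanSingleton F K β)
  have hL : ∀ z, L z = algebraMap F K z.1 + algebraMap F K z.2 * β := fun z => by
    simp [L, Algebra.smul_def]
  have hinj : Function.Injective L := by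
    rw [injective_iff_map_eq_zero]
    intro z hz
    rw [hL] at hz
    have hz' := congrArg σ hz
    simp only [map_add, map_mul, AlgHom.commutes, map_zero] at hz'
    -- Applying σ to a relation a + bβ = 0 and subtracting isolates b: 1 and β are independent
    -- because σ moves β.
    have h2 : algebraMap F K z.2 * (σ β - β) = 0 := by linear_combination hz' - hz
    have h3 : algebraMap F K z.2 = 0 :=
      (mul_eq_zero.1 h2).resolve_right (sub_ne_zero.2 hβ)
    rw [h3, zero_mul, add_zero] at hz
    exact Prod.ext (by simpa using hz) (by simpa using h3)
  have hfr : Module.finrank F (F × F) = Module.finrank F K := by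
    rw [h, Module.finrank_prod, Module.finrank_self]
  refine ⟨(LinearMap.linearEquivOfInjective L hinj hfr).symm, fun y => ?_⟩
  rw [← hL]
  exact ((LinearMap.linearEquivOfInjective L hinj hfr).apply_symm_apply y).symm

/-- A σ-fixed element has zero β-coordinate, so it lies in 𝔽_q, where the norm y ↦ y σ(y) is
surjective. -/
lemma exists_mul_frobenius_eq (h : Module.finrank F K = 2) {c : K} (hc : σ c = c) :
    ∃ l : K, l * σ l = c := by
  obtain ⟨β, hβ⟩ := exists_frobenius_ne h
  obtain ⟨e, he⟩ := exists_coordinates h hβ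
  have hc' := hc
  rw [he c] at hc'
  simp only [map_add, map_mul, AlgHom.commutes] at hc'
  have h2 : algebraMap F K (e c).2 * (σ β - β) = 0 := by linear_combination hc'
  have h3 : algebraMap F K (e c).2 = 0 :=
    (mul_eq_zero.1 h2).resolve_right (sub_ne_zero.2 hβ)
  obtain ⟨l, hl⟩ := FiniteField.norm_surjective F K (e c).1
  refine ⟨l, ?_⟩
  rw [he c, h3, zero_mul, add_zero, ← hl, FiniteField.algebraMap_norm_eq_pow,
    Module.natCard_eq_pow_finrank (K := F) (V := K), h, Nat.card_eq_fintype_card,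
    FiniteField.coe_frobeniusAlgHom, ← pow_succ']
  -- The norm exponent is (q² - 1) / (q - 1) = q + 1.
  congr 1
  symm
  have hq : 1 < Fintype.card F := Fintype.one_lt_card
  apply Nat.div_eq_of_eq_mul_left (by omega)
  simpa using Nat.sq_sub_sq (Fintype.card F) 1

end QuadraticExtension

/-! ### The Hermitian self-dual code [I | lA] -/

section DoubleCode

variable {K : Type*} [Field K] {k : ℕ}

/-- The codeword `(m, l m A)` of the code with generator matrix `[I | l A]`. -/
def codeword (l : K) (A : Matrix (Fin k) (Fin k) K) : (Fin k → K) →ₗ[K] (Fin k ⊕ Fin k → K) :=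
  LinearMap.pi (Sum.elim LinearMap.proj fun j => l • (LinearMap.proj j ∘ₗ A.vecMulLinear))

@[simp] lemma codeword_inl (l : K) (A : Matrix (Fin k) (Fin k) K) (m : Fin k → K) (i : Fin k) :
    codeword l A m (Sum.inl i) = m i := rfl

@[simp] lemma codeword_inr (l : K) (A : Matrix (Fin k) (Fin k) K) (m : Fin k → K) (i : Fin k) :
    codeword l A m (Sum.inr i) = l * (m ᵥ* A) i := rfl

lemma hammingNorm_codeword [DecidableEq K] {l : K} (hl : l ≠ 0) (A : Matrix (Fin k) (Fin k) K)
    (m : Fin k → K) :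
    hammingNorm (codeword l A m) = hammingNorm m + hammingNorm (m ᵥ* A) := by
  simp only [hammingNorm, Finset.card_filter, Fintype.sum_sum_type, codeword_inl, codeword_inr,
    ne_eq, mul_eq_zero, hl, false_or]
  congr!

/-- The code `[I | l A]` contains its Hermitian dual. -/
lemma eq_codeword_of_orthogonal {σ : K →+* K} {l c : K}
    {A : Matrix (Fin k) (Fin k) K} (hA : A * (A.map σ)ᵀ = c • (1 : Matrix (Fin k) (Fin k) K))
    (hl : l * σ l * c = -1) {u : Fin k ⊕ Fin k → K}
    (hu : ∀ m, ∑ j, u j * σ (codeword l A m j) = 0) :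
    u = codeword l A (fun i => u (Sum.inl i)) := by
  set a : Fin k → K := fun i => u (Sum.inl i) with ha
  set b : Fin k → K := fun i => u (Sum.inr i) with hb
  have hc : c ≠ 0 := by
    rintro rfl
    simp at hl
  have hab : a = -(σ l • (b ᵥ* (A.map σ)ᵀ)) := by
    ext i
    -- Orthogonality to the rows of the generator matrix expresses the left half of u through the
    -- right half.
    have h := hu (Pi.single i 1)
    rw [Fintype.sum_sum_type, Finset.sum_eq_single i (fun j _ hj => by simp [hj]) (by simp)] at h
    simp only [codeword_inl, codeword_inr, Pi.single_eq_same, map_one, mul_one,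
      Matrix.single_one_vecMul, map_mul] at h
    simp only [Pi.neg_apply, Pi.smul_apply, smul_eq_mul, Matrix.vecMul, dotProduct,
      Matrix.transpose_apply, Matrix.map_apply, Finset.mul_sum]
    rw [eq_neg_iff_add_eq_zero, ← h]
    congr 1
    refine Finset.sum_congr rfl fun j _ => ?_
    simp only [hb, Matrix.row_apply]
    ring
  -- A one-sided inverse of a square matrix is two-sided, so the relation can be solved for the
  -- right half.
  have hA' : (A.map σ)ᵀ * A = c • (1 : Matrix (Fin k) (Fin k) K) := by
    have h1 : A * (c⁻¹ • (A.map σ)ᵀ) = 1 := by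
      rw [Matrix.mul_smul, hA, smul_smul, inv_mul_cancel₀ hc, one_smul]
    have h2 := mul_eq_one_comm.1 h1
    rw [Matrix.smul_mul] at h2
    rw [← h2, smul_smul, mul_inv_cancel₀ hc, one_smul]
  have hb' : b = l • (a ᵥ* A) := by
    rw [hab, Matrix.neg_vecMul, Matrix.smul_vecMul, Matrix.vecMul_vecMul, hA', Matrix.vecMul_smul,
      Matrix.vecMul_one, smul_neg, smul_smul, smul_smul, hl, neg_one_smul, neg_neg]
  ext (j | j)
  · rfl
  · exact congrFun hb' j

end DoubleCode

/-! ### Puncturing, shortening and symplectic duality -/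

section Puncture

variable {F K : Type*} [Field F] [Field K] [Algebra F K] {k n : ℕ}

/-- The image in `𝔽_q²ⁿ` of the code `[I | l A]` punctured to the coordinates in the range
of `φ`. -/
def puncturedCode (e : K ≃ₗ[F] F × F) (l : K) (A : Matrix (Fin k) (Fin k) K)
    (φ : Fin n → Fin k ⊕ Fin k) : (Fin k → K) →ₗ[F] (Fin n → F × F) :=
  LinearMap.pi fun i => e.toLinearMap ∘ₗ LinearMap.proj (φ i) ∘ₗ
    (codeword l A).restrictScalars F

@[simp] lemma puncturedCode_apply (e : K ≃ₗ[F] F × F) (l : K) (A : Matrix (Fin k) (Fin k) K)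
    (φ : Fin n → Fin k ⊕ Fin k) (m : Fin k → K) (i : Fin n) :
    puncturedCode e l A φ m i = e (codeword l A m (φ i)) := rfl

lemma hammingNorm_equiv [DecidableEq F] [DecidableEq K] (e : K ≃ₗ[F] F × F) (u : Fin n → K) :
    hammingNorm (fun i => e (u i)) = hammingNorm u :=
  hammingNorm_comp (fun _ => e) (fun _ => e.injective) fun _ => map_zero e

/-- Each dropped coordinate costs at most one unit of weight; equivalently, zeros of the punctured
word are zeros of u. -/
lemma hammingNorm_le_comp_add [DecidableEq K] {J : Type*} [Fintype J] {φ : Fin n → J}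
    (hφ : Function.Injective φ) (u : J → K) :
    hammingNorm u + n ≤ hammingNorm (fun i => u (φ i)) + Fintype.card J := by
  classical
  have h1 := Finset.card_filter_add_card_filter_not (s := Finset.univ) (fun j => u j ≠ 0)
  have h2 := Finset.card_filter_add_card_filter_not (s := Finset.univ) (fun i => u (φ i) ≠ 0)
  have h3 : (Finset.univ.filter fun i => ¬ u (φ i) ≠ 0).card ≤
      (Finset.univ.filter fun j => ¬ u j ≠ 0).card :=
    Finset.card_le_card_of_injOn φ (fun i hi => by simpa using hi) hφ.injOn
  rw [Finset.card_univ] at h1 h2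
  rw [Fintype.card_fin] at h2
  change (Finset.univ.filter fun j => u j ≠ 0).card + n ≤
    (Finset.univ.filter fun i => u (φ i) ≠ 0).card + _
  omega

variable [Fintype F]

local notation "Φ" => FiniteField.frobeniusAlgHom F K

/-- In coordinates for the basis 1, β, the symplectic form is the Hermitian form minus its
conjugate, up to the factor σ(β) - β. -/
lemma symp_equiv {β : K} {e : K ≃ₗ[F] F × F}
    (he : ∀ y, y = algebraMap F K (e y).1 + algebraMap F K (e y).2 * β) (u w : Fin n → K) :
    algebraMap F K (symp F n (fun i => e (u i)) fun i => e (w i)) * (Φ β - β) =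
      ∑ i, (u i * Φ (w i) - Φ (u i) * w i) := by
  rw [symp_apply, map_sum, Finset.sum_mul]
  refine Finset.sum_congr rfl fun i _ => ?_
  conv_rhs => rw [he (u i), he (w i)]
  simp only [map_add, map_mul, map_sub, AlgHom.commutes]
  ring

variable [Finite K]

/-- Symplectic orthogonality to a K-linear code upgrades to Hermitian orthogonality. With z the
Hermitian product, replacing w by α w gives σ(α) z = α σ(z); α = 1 and α = β then force z = 0. -/
lemma sum_mul_frobenius_eq_zero (hFK : Module.finrank F K = 2) {β : K} (hβ : Φ β ≠ β)
    {e : K ≃ₗ[F] F × F} (he : ∀ y, y = algebraMap F K (e y).1 + algebraMap F K (e y).2 * β)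
    {u : Fin n → K} (C : Submodule K (Fin n → K))
    (hu : ∀ w ∈ C, symp F n (fun i => e (u i)) (fun i => e (w i)) = 0) {w : Fin n → K}
    (hw : w ∈ C) : ∑ i, u i * Φ (w i) = 0 := by
  have key : ∀ α : K, Φ α * ∑ i, u i * Φ (w i) = α * Φ (∑ i, u i * Φ (w i)) := by
    intro α
    have h := symp_equiv he u (α • w)
    rw [hu _ (C.smul_mem α hw), map_zero, zero_mul, Finset.sum_sub_distrib, eq_comm,
      sub_eq_zero] at h
    rw [map_sum, Finset.mul_sum, Finset.mul_sum]
    convert h using 2 with i _ i _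
    · simp only [Pi.smul_apply, smul_eq_mul, map_mul]
      ring
    · simp only [Pi.smul_apply, smul_eq_mul, map_mul, frobenius_frobenius hFK]
      ring
  have h1 := key 1
  have h2 := key β
  rw [map_one, one_mul, one_mul] at h1
  rw [← h1] at h2
  by_contra hne
  exact hβ (mul_right_cancel₀ hne h2)

variable [DecidableEq F] [DecidableEq K]

/-- The map φ selects the coordinates that are kept. Keeping the whole left half makes puncturing
injective and leaves the weight of a row of the generator matrix under control. -/
theorem exists_isCode_of_doubleCode (p : ℕ) [Fact p.Prime] [Algebra (ZMod p) F]
    (hFK : Module.finrank F K = 2) {l c : K} {A : Matrix (Fin k) (Fin k) K} (hk : 0 < k)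
    (hminors : SmallMinorsNeZero A)
    (hA : A * (A.map (Φ : K →+* K))ᵀ = c • (1 : Matrix (Fin k) (Fin k) K))
    (hl : l * Φ l * c = -1) {r : ℕ} (hr : r < k) (hn : n + r = 2 * k)
    (φ : Fin n → Fin k ⊕ Fin k) (hφ : Function.Injective φ) (hφl : ∀ j, ∃ i, φ i = Sum.inl j) :
    ∃ Q : Submodule ℂ (States F n), IsCode p Q r (k + 1 - r) := by
  have hl0 : l ≠ 0 := by
    rintro rfl
    simp at hl
  have hc0 : c ≠ 0 := by
    rintro rfl
    simp at hl
  obtain ⟨β, hβ⟩ := exists_frobenius_ne hFK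
  obtain ⟨e, he⟩ := exists_coordinates hFK hβ
  have hJ : Fintype.card (Fin k ⊕ Fin k) = 2 * k := by simp [two_mul]
  have hwt : ∀ m : Fin k → K, m ≠ 0 → k < hammingNorm (codeword l A m) := fun m hm => by
    rw [hammingNorm_codeword hl0]
    exact hminors.lt_hammingNorm_add_of_mul_eq (hminors.map_transpose _) hc0 hA hm
  have hinj : Function.Injective (puncturedCode e l A φ) := by
    rw [injective_iff_map_eq_zero]
    intro m hm
    ext j
    obtain ⟨i, hi⟩ := hφl j
    simpa [hi] using congrFun hm i
  set D := LinearMap.range (puncturedCode e l A φ) with hD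
  have hfD : Module.finrank F D = 2 * k := by
    rw [hD, LinearMap.finrank_range_of_inj hinj, Module.finrank_pi_fintype]
    simp [hFK, mul_comm]
  set S := (symp F n).orthogonal D with hSdef
  have hfS : Module.finrank F S + r = n := by
    rw [hSdef, LinearMap.BilinForm.finrank_orthogonal (symp_nondegenerate F n), hfD,
      Module.finrank_pi_fintype]
    simp only [Module.finrank_prod, Module.finrank_self, Finset.sum_const, Finset.card_univ,
      Fintype.card_fin, smul_eq_mul]
    omega
  have hSD' : (symp F n).orthogonal S = D :=
    LinearMap.BilinForm.orthogonal_orthogonal (symp_nondegenerate F n) (symp_isAlt F n).isRefl D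
  -- S is the shortened code: s extended by zero is Hermitian-orthogonal to C, hence in C by
  -- self-duality. The extension adds no weight, so nonzero elements of S have weight above k.
  have hext : ∀ s ∈ S, ∃ m, s = puncturedCode e l A φ m ∧
      hammingNorm (codeword l A m) ≤ hammingNorm s := by
    intro s hs
    set u : Fin n → K := fun i => e.symm (s i) with hu
    have hs' : s = fun i => e (u i) := by
      ext1 i
      simp [hu]
    set U : Fin k ⊕ Fin k → K := Function.extend φ u fun _ => 0 with hU
    have hUφ : ∀ i, U (φ i) = u i := fun i => hφ.extend_apply _ _ i
    have hU0 : ∀ j, (∀ i, φ i ≠ j) → U j = 0 := fun j hj =>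
      Function.extend_apply' _ _ j fun ⟨i, hi⟩ => hj i hi
    let C : Submodule K (Fin n → K) := LinearMap.range (LinearMap.funLeft K K φ ∘ₗ codeword l A)
    have horth : ∀ w ∈ C, symp F n (fun i => e (u i)) (fun i => e (w i)) = 0 := by
      rintro _ ⟨m, rfl⟩
      rw [← hs']
      exact (symp_isAlt F n).isRefl _ _ (hs _ ⟨m, rfl⟩)
    have hcw : U = codeword l A fun i => U (Sum.inl i) := by
      refine eq_codeword_of_orthogonal (σ := (Φ : K →+* K)) hA hl
        fun m => ?_
      have h := sum_mul_frobenius_eq_zero hFK hβ he C horth ⟨m, rfl⟩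
      rw [← h]
      symm
      refine Finset.sum_of_injOn φ hφ.injOn (by simp [Set.MapsTo]) (fun j _ hj => ?_)
        fun i _ => ?_
      · rw [hU0 j fun i hi => hj ⟨i, by simp, hi⟩, zero_mul]
      · rw [hUφ]
        rfl
    refine ⟨fun i => U (Sum.inl i), ?_, ?_⟩
    · ext1 i
      rw [puncturedCode_apply, ← hcw, hUφ, hs']
    · rw [← hcw, hs', hammingNorm_equiv]
      refine Finset.card_le_card_of_surjOn φ fun j hj => ?_
      simp only [Finset.coe_filter, Finset.mem_univ, true_and, Set.mem_ofPred_eq] at hj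
      obtain ⟨i, rfl⟩ : ∃ i, φ i = j := by
        by_contra! hall
        exact hj (hU0 j hall)
      exact ⟨i, by simpa [hUφ] using hj, rfl⟩
  have hSleD : S ≤ D := fun s hs => by
    obtain ⟨m, hm, _⟩ := hext s hs
    exact ⟨m, hm.symm⟩
  have hmemD : ∀ t, (∀ s ∈ S, symp F n s t = 0) ↔ t ∈ D := fun t => by
    rw [← hSD', LinearMap.BilinForm.mem_orthogonal_iff]
  have hmin : ∀ t, t ≠ 0 → (∀ s ∈ S, symp F n s t = 0) → k + 1 - r ≤ hammingNorm t := by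
    intro t ht hts
    obtain ⟨m, rfl⟩ := (hmemD t).1 hts
    have hm : m ≠ 0 := by
      rintro rfl
      exact ht (map_zero _)
    have h1 := hwt m hm
    have h2 := hammingNorm_le_comp_add hφ (codeword l A m)
    rw [hJ] at h2
    have h3 := hammingNorm_equiv e (fun i => codeword l A m (φ i))
    have h4 : hammingNorm (puncturedCode e l A φ m) = _ := h3
    omega
  refine exists_isCode (p := p) (S := S) (fun s hs t ht => (hmemD t).2 (hSleD ht) s hs) hfS (by omega)
    hmin ?_
  -- A punctured row of [I | lA] vanishes at the other k - 1 left positions, so its weight is at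
  -- most n - (k - 1) = k + 1 - r and the bound is attained.
  let j₀ : Fin k := ⟨0, hk⟩
  set t := puncturedCode e l A φ (Pi.single j₀ 1) with ht
  have htD : t ∈ D := ⟨_, rfl⟩
  have ht0 : t ≠ 0 := fun h => by
    have h' := hinj (h.trans (map_zero _).symm)
    simpa using congrFun h' j₀
  have htle : hammingNorm t ≤ k + 1 - r := by
    choose ψ hψ using hφl
    have hψi : Function.Injective ψ := fun a b hab => by
      have h := congrArg φ hab
      rw [hψ, hψ] at h
      exact Sum.inl_injective h
    have h1 := Finset.card_filter_add_card_filter_not (s := Finset.univ) (fun i => t i ≠ 0)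
    have h2 : (Finset.univ.erase j₀).card ≤ (Finset.univ.filter fun i => ¬ t i ≠ 0).card := by
      refine Finset.card_le_card_of_injOn ψ (fun j hj => ?_) hψi.injOn
      have hj' : j ≠ j₀ := by simpa using hj
      simp [ht, hψ, hj']
    rw [Finset.card_erase_of_mem (Finset.mem_univ _), Finset.card_univ, Fintype.card_fin] at h2
    rw [Finset.card_univ, Fintype.card_fin] at h1
    unfold hammingNorm
    omega
  have htwt : hammingNorm t = k + 1 - r :=
    le_antisymm htle (hmin t ht0 ((hmemD t).2 htD))
  refine ⟨t, (hmemD t).2 htD, htwt, fun htS => ?_, fun hr0 => ?_⟩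
  -- Membership in S would give weight above k, whereas t has weight k + 1 - r; this leaves only r =
  -- 0.
  · obtain ⟨m, hm, hle⟩ := hext t htS
    have hm0 : m ≠ 0 := by
      rintro rfl
      exact ht0 (hm.trans (map_zero _))
    have h := hwt m hm0
    omega
  -- For r = 0 both S and D have dimension 2k, so S = D.
  · rwa [Submodule.eq_of_le_of_finrank_eq hSleD (by omega)]

end Puncture

end
end QuantumCode

/-! ### Assembly: the field embedding and the main theorem -/

namespace QuantumCode

/-- Cardinalities force K to have characteristic p and degree over 𝔽_p twice that of F, so F embeds
in K. -/
lemma exists_algebra_finrank_eq_two (p : ℕ) [Fact p.Prime] (F K : Type*) [Field F] [Fintype F]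
    [Algebra (ZMod p) F] [Field K] [Fintype K] (h : Fintype.card K = Fintype.card F ^ 2) :
    ∃ _ : Algebra F K, Module.finrank F K = 2 := by
  have hF := Module.card_eq_pow_finrank (K := ZMod p) (V := F)
  rw [ZMod.card] at hF
  have hp : (p : K) = 0 := by
    have h1 : ((Fintype.card K : ℕ) : K) = 0 := FiniteField.cast_card_eq_zero K
    rw [h, hF] at h1
    push_cast at h1
    exact eq_zero_of_pow_eq_zero (eq_zero_of_pow_eq_zero h1)
  have : CharP K p := (CharP.charP_iff_prime_eq_zero Fact.out).2 hp
  let : Algebra (ZMod p) K := ZMod.algebra K p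
  have hK := Module.card_eq_pow_finrank (K := ZMod p) (V := K)
  rw [ZMod.card, h, hF, ← pow_mul] at hK
  have hfr := Nat.pow_right_injective (Fact.out : p.Prime).two_le hK
  obtain ⟨f⟩ := FiniteField.nonempty_algHom_of_finrank_dvd (F := ZMod p) (K := F) (L := K)
    ⟨2, hfr.symm⟩
  let : Algebra F K := f.toRingHom.toAlgebra
  refine ⟨inferInstance, ?_⟩
  have hFK := Module.card_eq_pow_finrank (K := F) (V := K)
  rw [h] at hFK
  exact (Nat.pow_right_injective Fintype.one_lt_card hFK).symm

end QuantumCode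

theorem mainTheorem4
    (p q : ℕ) [Fact p.Prime]
    (F : Type*) [Field F] [Fintype F] [DecidableEq F] [Algebra (ZMod p) F]
    (hF : Fintype.card F = q)
    (K : Type*) [Field K] [Fintype K] (hK : Fintype.card K = q ^ 2)
    (k : ℕ) [NeZero k] (x : Fin k → K)
    (hM : (QuantumCode.rowCirculant x).det ≠ 0)
    (hsub : ∀ m : ℕ, 1 ≤ m → m ≤ k / 2 → ∀ f g : Fin m ↪o Fin k,
      ((QuantumCode.rowCirculant x).submatrix f g).det ≠ 0)
    (hH : ∀ m : ℕ, 1 ≤ m → m ≤ k / 2 → QuantumCode.H q m x = 0)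
    (hx : ∑ i : Fin k, x i ^ (q + 1) ≠ 0)
    (r : ℕ) (hr : r < k) :
    ∃ Q : Submodule ℂ (QuantumCode.States F (2 * k - r)),
      QuantumCode.IsMDSCode p Q r (k + 1 - r) := by
  classical
  subst hF
  obtain ⟨_, hFK⟩ := QuantumCode.exists_algebra_finrank_eq_two p F K hK
  let σ := FiniteField.frobeniusAlgHom F K
  have hσσ : ∀ y, σ (σ y) = y := QuantumCode.frobenius_frobenius hFK
  have hgram := QuantumCode.rowCirculant_mul_map_transpose (σ := (σ : K →+* K))
    (fun _ => rfl) hσσ hH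
  set c := ∑ i : Fin k, x i ^ (Fintype.card F + 1) with hc
  -- c is a sum of norms y σ(y), each fixed by σ because σ² = 1.
  have hσc : σ c = c := by
    have e : ∀ y : K, y ^ (Fintype.card F + 1) = y * σ y := fun y => pow_succ' y _
    simp only [hc, e, map_sum, map_mul, hσσ, mul_comm]
  obtain ⟨l, hl⟩ := QuantumCode.exists_mul_frobenius_eq hFK (c := -c⁻¹) (by
    rw [map_neg, map_inv₀]
    exact congrArg (fun y => -y⁻¹) hσc)
  -- The kept coordinates are the whole left half and the first k - r of the right half.
  let ψ : Fin (2 * k - r) ≃ Fin k ⊕ Fin (k - r) :=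
    (finCongr (by omega)).trans finSumFinEquiv.symm
  obtain ⟨Q, hQ⟩ := QuantumCode.exists_isCode_of_doubleCode (n := 2 * k - r) p hFK (l := l)
    (NeZero.pos k) hsub hgram (by rw [hl, neg_mul, inv_mul_cancel₀ hx]) hr (by omega)
    (Sum.map id (Fin.castLE (Nat.sub_le k r)) ∘ ψ)
    ((Function.injective_id.sumMap (Fin.castLE_injective _)).comp ψ.injective)
    fun j => ⟨ψ.symm (Sum.inl j), by simp⟩
  exact ⟨Q, hQ, by omega⟩
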